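/- For a set $X\subset\mathbb C^n$ and $x,y\in X$ let $d_X(x,y)\in[0,\infty]$ be the infimum of the lengths of the continuous paths in $X$ joining $x$ to $y$ ($d_X(x,y)=\infty$ if there is no such path of finite length). The set $X$ is called normally embedded if there is a constant $C>0$ with $d_X(x,y)\le C\|x-y\|$ for all $x,y\in X$, where $\|\cdot\|$ is the Euclidean norm; it is called normally embedded at a point $p\in X$ if $U\cap X$ is normally embedded for some neighborhood $U$ of $p$. Corollary 4.3 (Brieskorn). Let $n\ge 2$, let $a_1,\dots,a_n$ be nonzero complex numbers, and let $k_1,\dots,k_n$ be integers with $1<k_1<k_2$ and $k_2\le\cdots\le k_n$. Then the Pham–Brieskorn hypersurface $$X=\{x\in\mathbb C^n \mid a_1x_1^{k_1}+\cdots+a_nx_n^{k_n}=0\}$$ is not normally embedded at the origin. -/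

import Mathlib

open scoped ENNReal NNReal Topology

/-- The inner distance of a subset `X` of a metric space: the infimum of the lengths of the
continuous paths from `x` to `y` that stay in `X`. It is `∞` if there is no such path of finite
length. -/
noncomputable def innerEDist {E : Type*} [PseudoEMetricSpace E] (X : Set E) (x y : E) : ℝ≥0∞ :=
  ⨅ (γ : Path x y) (_ : ∀ t, γ t ∈ X), eVariationOn γ Set.univ

/-- `X` is (Lipschitz) normally embedded: the inner distance is at most a finite constant times
the outer distance. -/
def IsNormallyEmbedded {E : Type*} [PseudoEMetricSpace E] (X : Set E) : Prop :=
  ∃ C : ℝ≥0, 0 < C ∧ ∀ x ∈ X, ∀ y ∈ X, innerEDist X x y ≤ C * edist x y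

/-- `X` is normally embedded at the point `p`: some neighborhood `U` of `p` is such that `U ∩ X`
is normally embedded. -/
def IsNormallyEmbeddedAt {E : Type*} [PseudoEMetricSpace E] (X : Set E) (p : E) : Prop :=
  ∃ U ∈ 𝓝 p, IsNormallyEmbedded (U ∩ X)

/-- The Pham-Brieskorn hypersurface `∑ aᵢ xᵢ ^ kᵢ = 0` in `ℂⁿ` with its Euclidean metric. -/
def phamBrieskorn {n : ℕ} (a : Fin n → ℂ) (k : Fin n → ℕ) : Set (EuclideanSpace ℂ (Fin n)) :=
  {x | ∑ i, a i * x i ^ k i = 0}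

/-!
Write `i₀` for the index of the smallest exponent and `i₁` for that of the second smallest. Over
the point `x i₁ = t` of the `i₁`-axis, the hypersurface has the points with
`a i₀ * x i₀ ^ k i₀ = - a i₁ * t ^ k i₁` and all other coordinates `0`. Two of them, for different
roots `x i₀`, are at distance `O(|t| ^ (k i₁ / k i₀)) = o(|t|)`. But in a ball of radius `ε|t|`
around the point of the axis, the other terms of the equation are so close to `a i₁ * t ^ k i₁` that
the power `x i₀ ^ k i₀` stays in a slit plane, on which all branches of the root are continuous. A
path in the hypersurface between the two points changes the branch, so it leaves this ball and
has length at least of order `|t|`.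
-/

theorem exists_path_of_innerEDist_lt {E : Type*} [PseudoMetricSpace E] {X : Set E} {x y : E}
    {r : ℝ} (h : innerEDist X x y < ENNReal.ofReal r) :
    ∃ γ : Path x y, Set.range γ ⊆ X ∩ Metric.ball x r := by
  simp only [innerEDist, iInf_lt_iff] at h
  obtain ⟨γ, hγ, hlength⟩ := h
  refine ⟨γ, Set.range_subset_iff.mpr fun t => ⟨hγ t, ?_⟩⟩
  have hdist : edist (γ t) x ≤ eVariationOn γ Set.univ := by
    simpa only [γ.source] using eVariationOn.edist_le γ (Set.mem_univ t) (Set.mem_univ 0)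
  rw [← Metric.eball_ofReal]
  exact hdist.trans_lt hlength

theorem IsNormallyEmbeddedAt.exists_path_subset_ball {E : Type*} [PseudoMetricSpace E] {X : Set E}
    {p : E} (h : IsNormallyEmbeddedAt X p) :
    ∃ K > 0, ∃ U ∈ 𝓝 p, ∀ c r, ∀ x ∈ U ∩ X ∩ Metric.ball c r, ∀ y ∈ U ∩ X ∩ Metric.ball c r,
      ∃ γ : Path x y, Set.range γ ⊆ X ∩ Metric.ball c (K * r) := by
  obtain ⟨U, hU, C, -, hC⟩ := h
  refine ⟨2 * C + 2, by positivity, U, hU, fun c r x ⟨hx, hxc⟩ y ⟨hy, hyc⟩ => ?_⟩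
  rw [Metric.mem_ball] at hxc hyc
  have hr : 0 < r := dist_nonneg.trans_lt hxc
  have hxy : C * dist x y < (2 * C + 1) * r := by
    have : dist x y ≤ 2 * r := by linarith [dist_triangle_right x y c]
    nlinarith [C.coe_nonneg]
  have hlt : innerEDist (U ∩ X) x y < ENNReal.ofReal ((2 * C + 1) * r) := by
    refine (hC x hx y hy).trans_lt ?_
    rwa [edist_dist, ← ENNReal.ofReal_coe_nnreal, ← ENNReal.ofReal_mul C.coe_nonneg,
      ENNReal.ofReal_lt_ofReal_iff_of_nonneg (by positivity)]
  obtain ⟨γ, hγ⟩ := exists_path_of_innerEDist_lt hlt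
  exact ⟨γ, hγ.trans (Set.inter_subset_inter Set.inter_subset_right
    (Metric.ball_subset_ball' (by linarith)))⟩

theorem eq_of_pow_eq_of_mul_pow_mem_slitPlane {X : Type*} [TopologicalSpace X] {S : Set X}
    (hS : IsPreconnected S) {m : ℕ} (hm : m ≠ 0) {f : X → ℂ} (hf : ContinuousOn f S) {w : ℂ}
    (hw : ∀ x ∈ S, w * f x ^ m ∈ Complex.slitPlane) {x y : X} (hx : x ∈ S) (hy : y ∈ S)
    (hxy : f x ^ m = f y ^ m) : f x = f y := by
  let g : X → ℂ := fun x => (w * f x ^ m) ^ (m⁻¹ : ℂ)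
  have hg : ContinuousOn g S := (continuousOn_const.mul (hf.pow m)).cpow_const hw
  have hgm : ∀ x, g x ^ m = w * f x ^ m := fun x => Complex.cpow_nat_inv_pow _ hm
  have hg0 : ∀ x ∈ S, g x ≠ 0 := fun x hx h0 => by
    apply Complex.slitPlane_ne_zero (hw x hx)
    rw [← hgm, h0, zero_pow hm]
  have hroots : Set.MapsTo (fun x => f x / g x) S (Polynomial.nthRoots m w⁻¹).toFinset := by
    intro x hx
    have h0 := Complex.slitPlane_ne_zero (hw x hx)
    rw [Finset.mem_coe, Multiset.mem_toFinset, Polynomial.mem_nthRoots (Nat.pos_of_ne_zero hm),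
      div_pow, hgm, div_eq_iff h0, inv_mul_cancel_left₀ (left_ne_zero_of_mul h0)]
  have hquot : f x / g x = f y / g y :=
    hS.constant_of_mapsTo (Finset.finite_toSet _).isDiscrete (hf.div hg hg0) hroots hx hy
  have hgxy : g x = g y := by simp only [g, hxy]
  rwa [hgxy, div_left_inj' (hg0 y hy)] at hquot

theorem eventually_norm_lt_of_pow_eq_mul_pow {m l : ℕ} (hml : m < l) (b : ℂ) {η : ℝ} (hη : 0 < η) :
    ∀ᶠ t : ℂ in 𝓝[≠] 0, ∀ d : ℂ, d ^ m = b * t ^ l → ‖d‖ < η * ‖t‖ := by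
  have hsmall : ∀ᶠ t : ℂ in 𝓝[≠] 0, ‖b * t ^ (l - m)‖ < η ^ m := by
    refine nhdsWithin_le_nhds (ContinuousAt.eventually_lt (by fun_prop) continuousAt_const ?_)
    simpa [(Nat.sub_pos_of_lt hml).ne'] using pow_pos hη m
  filter_upwards [hsmall, self_mem_nhdsWithin] with t ht ht0 d hd
  refine lt_of_pow_lt_pow_left₀ m (by positivity) ?_
  calc ‖d‖ ^ m = ‖b * t ^ (l - m)‖ * ‖t‖ ^ m := by
        rw [← norm_pow, hd, ← norm_pow, ← norm_mul, mul_assoc, pow_sub_mul_pow t hml.le]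
    _ < η ^ m * ‖t‖ ^ m := by
        have := norm_pos_iff.mpr ht0
        gcongr
    _ = (η * ‖t‖) ^ m := (mul_pow ..).symm

theorem eventually_exists_ne_pow_eq_mul_pow {m l : ℕ} (hm : 1 < m) (hml : m < l) {b : ℂ}
    (hb : b ≠ 0) {η : ℝ} (hη : 0 < η) :
    ∀ᶠ t : ℂ in 𝓝[≠] 0, ∃ d₁ d₂ : ℂ, d₁ ≠ d₂ ∧ (d₁ ^ m = b * t ^ l ∧ ‖d₁‖ < η * ‖t‖) ∧
      (d₂ ^ m = b * t ^ l ∧ ‖d₂‖ < η * ‖t‖) := by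
  have hm0 : m ≠ 0 := by lia
  filter_upwards [eventually_norm_lt_of_pow_eq_mul_pow hml b hη, self_mem_nhdsWithin]
    with t hnorm ht
  obtain ⟨d, hd⟩ := IsAlgClosed.exists_pow_nat_eq (b * t ^ l) (Nat.pos_of_ne_zero hm0)
  have hd0 : d ≠ 0 := by
    rintro rfl
    rw [zero_pow hm0] at hd
    exact mul_ne_zero hb (pow_ne_zero l ht) hd.symm
  have hω := Complex.isPrimitiveRoot_exp m hm0
  set ω := Complex.exp (2 * Real.pi * Complex.I / m)
  have hωd : (ω * d) ^ m = b * t ^ l := by rw [mul_pow, hω.pow_eq_one, one_mul, hd]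
  exact ⟨ω * d, d, fun h => hω.ne_one hm (mul_eq_right₀ hd0 |>.mp h), ⟨hωd, hnorm _ hωd⟩,
    hd, hnorm d hd⟩

theorem eventually_single_add_single_mem {ι : Type*} [Finite ι] [DecidableEq ι] {i j : ι}
    {U : Set (EuclideanSpace ℂ ι)} (hU : U ∈ 𝓝 0) (η : ℝ) :
    ∀ᶠ t in 𝓝[≠] (0 : ℂ), ∀ d, ‖d‖ < η * ‖t‖ →
      EuclideanSpace.single i d + EuclideanSpace.single j t ∈ U := by
  cases nonempty_fintype ι
  obtain ⟨δ, hδ, hδU⟩ := Metric.mem_nhds_iff.mp hU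
  have hsmall : ∀ᶠ t : ℂ in 𝓝[≠] 0, η * ‖t‖ + ‖t‖ < δ := by
    refine nhdsWithin_le_nhds (ContinuousAt.eventually_lt (by fun_prop) continuousAt_const ?_)
    simpa using hδ
  filter_upwards [hsmall] with t ht d hd
  apply hδU
  rw [mem_ball_zero_iff]
  calc ‖EuclideanSpace.single i d + EuclideanSpace.single j t‖
      ≤ ‖d‖ + ‖t‖ := by
        simpa only [PiLp.norm_single] using
          norm_add_le (EuclideanSpace.single i d) (EuclideanSpace.single j t)
    _ < δ := by linarith

section rescaledTail

variable {ι : Type*} [Fintype ι] [DecidableEq ι]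

/-- The terms with `i ≠ i₀` of the equation `∑ i, a i * x i ^ k i = 0` at `x = t • z`, divided by
`a i₁ * t ^ k i₁`. The subtraction of exponents is meant for `k i₁` the smallest of the exponents
occurring in these terms, so that the quotient is a polynomial in `t` and `z`. -/
noncomputable def rescaledTail (a : ι → ℂ) (k : ι → ℕ) (i₀ i₁ : ι) (t : ℂ)
    (z : EuclideanSpace ℂ ι) : ℂ :=
  ∑ i ∈ Finset.univ.erase i₀, a i / a i₁ * t ^ (k i - k i₁) * z i ^ k i

variable {a : ι → ℂ} {k : ι → ℕ} {i₀ i₁ : ι}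

theorem continuous_rescaledTail :
    Continuous fun p : ℂ × EuclideanSpace ℂ ι => rescaledTail a k i₀ i₁ p.1 p.2 := by
  unfold rescaledTail
  fun_prop

theorem rescaledTail_single_one (hi : i₁ ≠ i₀) (ha : a i₁ ≠ 0) (hk₁ : k i₁ ≠ 0)
    (hk : ∀ i ≠ i₀, a i ≠ 0 → k i₁ ≤ k i) (t : ℂ) :
    rescaledTail a k i₀ i₁ t (EuclideanSpace.single i₁ 1) = 1 := by
  rw [rescaledTail, Finset.sum_eq_single_of_mem i₁ (by simp [hi])]
  · simp [ha]
  · intro i hi₀ hi₁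
    by_cases hai : a i = 0
    · simp [hai]
    · have hki : k i ≠ 0 :=
        ((Nat.pos_of_ne_zero hk₁).trans_le (hk i (Finset.ne_of_mem_erase hi₀) hai)).ne'
      simp [hi₁, hki]

theorem mul_pow_eq_rescaledTail (ha : a i₁ ≠ 0) (hk : ∀ i ≠ i₀, a i ≠ 0 → k i₁ ≤ k i) {t : ℂ}
    (ht : t ≠ 0) {x : EuclideanSpace ℂ ι} (hx : ∑ i, a i * x i ^ k i = 0) :
    -(a i₀ / (a i₁ * t ^ k i₁)) * x i₀ ^ k i₀ = rescaledTail a k i₀ i₁ t (t⁻¹ • x) := by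
  have hterm : ∀ i ∈ Finset.univ.erase i₀,
      a i / a i₁ * t ^ (k i - k i₁) * (t⁻¹ • x) i ^ k i = a i * x i ^ k i / (a i₁ * t ^ k i₁) := by
    intro i hi
    by_cases hai : a i = 0
    · simp [hai]
    · rw [pow_sub₀ t ht (hk i (Finset.ne_of_mem_erase hi) hai), PiLp.smul_apply, smul_eq_mul,
        mul_pow, inv_pow]
      field_simp
  rw [rescaledTail, Finset.sum_congr rfl hterm, ← Finset.sum_div]
  rw [← Finset.add_sum_erase _ _ (Finset.mem_univ i₀)] at hx
  rw [eq_neg_of_add_eq_zero_right hx]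
  ring

theorem exists_pos_forall_rescaledTail_mem_slitPlane (hi : i₁ ≠ i₀) (ha : a i₁ ≠ 0)
    (hk₁ : k i₁ ≠ 0) (hk : ∀ i ≠ i₀, a i ≠ 0 → k i₁ ≤ k i) :
    ∃ ε > 0, ∀ᶠ t in 𝓝 0, ∀ z ∈ Metric.ball (EuclideanSpace.single i₁ 1) ε,
      rescaledTail a k i₀ i₁ t z ∈ Complex.slitPlane := by
  have hnear : ∀ᶠ p : ℂ × EuclideanSpace ℂ ι in 𝓝 (0, EuclideanSpace.single i₁ 1),
      rescaledTail a k i₀ i₁ p.1 p.2 ∈ Complex.slitPlane := by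
    refine continuous_rescaledTail.continuousAt.eventually_mem
      (Complex.isOpen_slitPlane.mem_nhds ?_)
    simp only [rescaledTail_single_one hi ha hk₁ hk, Complex.one_mem_slitPlane]
  rw [nhds_prod_eq, Metric.eventually_prod_nhds_iff] at hnear
  obtain ⟨P, hP, ε, hε, h⟩ := hnear
  exact ⟨ε, hε, hP.mono fun t ht z hz => h ht hz⟩

end rescaledTail

section phamBrieskorn

variable {n : ℕ} {a : Fin n → ℂ} {k : Fin n → ℕ} {i₀ i₁ : Fin n}

theorem single_add_single_mem_phamBrieskorn_iff (hi : i₁ ≠ i₀)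
    (hk : ∀ i ≠ i₀, a i ≠ 0 → k i ≠ 0) {d t : ℂ} :
    EuclideanSpace.single i₀ d + EuclideanSpace.single i₁ t ∈ phamBrieskorn a k ↔
      a i₀ * d ^ k i₀ + a i₁ * t ^ k i₁ = 0 := by
  rw [phamBrieskorn, Set.mem_ofPred_eq, Fintype.sum_eq_add i₀ i₁ hi.symm]
  · simp [hi, hi.symm]
  · rintro i ⟨hi₀, hi₁⟩
    by_cases hai : a i = 0
    · simp [hai]
    · simp [hi₀, hi₁, hk i hi₀ hai]

theorem exists_pos_eventually_coord_eq (hi : i₁ ≠ i₀) (ha : a i₁ ≠ 0) (hk₀ : k i₀ ≠ 0)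
    (hk₁ : k i₁ ≠ 0) (hk : ∀ i ≠ i₀, a i ≠ 0 → k i₁ ≤ k i) :
    ∃ ε > 0, ∀ᶠ t in 𝓝[≠] (0 : ℂ), ∀ S : Set (EuclideanSpace ℂ (Fin n)), IsPreconnected S →
      S ⊆ phamBrieskorn a k ∩ Metric.ball (EuclideanSpace.single i₁ t) (ε * ‖t‖) →
      ∀ x ∈ S, ∀ y ∈ S, x i₀ ^ k i₀ = y i₀ ^ k i₀ → x i₀ = y i₀ := by
  obtain ⟨ε, hε, hslit⟩ := exists_pos_forall_rescaledTail_mem_slitPlane hi ha hk₁ hk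
  refine ⟨ε, hε, ?_⟩
  filter_upwards [nhdsWithin_le_nhds hslit, self_mem_nhdsWithin] with t ht ht0 S hS hSX x hx y hy
  refine eq_of_pow_eq_of_mul_pow_mem_slitPlane hS hk₀ (f := fun z => z i₀)
    (w := -(a i₀ / (a i₁ * t ^ k i₁))) (by fun_prop) (fun z hz => ?_) hx hy
  rw [mul_pow_eq_rescaledTail ha hk ht0 (hSX hz).1]
  apply ht
  have hcenter : EuclideanSpace.single i₁ (1 : ℂ) = t⁻¹ • EuclideanSpace.single i₁ t := by
    ext i
    simp [inv_mul_cancel₀ ht0]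
  rw [Metric.mem_ball, hcenter, dist_smul₀, norm_inv, inv_mul_lt_iff₀ (norm_pos_iff.mpr ht0),
    mul_comm]
  exact (hSX hz).2

theorem not_isNormallyEmbeddedAt_phamBrieskorn (ha₀ : a i₀ ≠ 0) (ha₁ : a i₁ ≠ 0) (hk₀ : 1 < k i₀)
    (hlt : k i₀ < k i₁) (hk : ∀ i ≠ i₀, a i ≠ 0 → k i₁ ≤ k i) :
    ¬ IsNormallyEmbeddedAt (phamBrieskorn a k) 0 := by
  have hi : i₁ ≠ i₀ := ne_of_apply_ne k hlt.ne'
  intro hX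
  obtain ⟨K, hK, U, hU, hpath⟩ := hX.exists_path_subset_ball
  obtain ⟨ε, hε, hcoord⟩ :=
    exists_pos_eventually_coord_eq hi ha₁ (by lia : k i₀ ≠ 0) hlt.ne_bot hk
  obtain ⟨t, hcoord_eq, hU_mem, d₁, d₂, hd, ⟨hd₁, hd₁t⟩, hd₂, hd₂t⟩ :=
    (hcoord.and <| (eventually_single_add_single_mem hU (ε / K)).and <|
      eventually_exists_ne_pow_eq_mul_pow hk₀ hlt (neg_ne_zero.mpr (div_ne_zero ha₁ ha₀))
        (div_pos hε hK)).exists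
  let x : ℂ → EuclideanSpace ℂ (Fin n) := fun d =>
    EuclideanSpace.single i₀ d + EuclideanSpace.single i₁ t
  have hx : ∀ d, d ^ k i₀ = -(a i₁ / a i₀) * t ^ k i₁ → ‖d‖ < ε / K * ‖t‖ →
      x d ∈ U ∩ phamBrieskorn a k ∩ Metric.ball (EuclideanSpace.single i₁ t) (ε / K * ‖t‖) := by
    intro d hpow hdt
    refine ⟨⟨hU_mem d hdt, ?_⟩, ?_⟩
    · rw [single_add_single_mem_phamBrieskorn_iff hi
        fun i hi₀ hai => (hlt.trans_le (hk i hi₀ hai)).ne_bot, hpow]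
      field_simp
      ring
    · rwa [Metric.mem_ball, dist_add_self_left, PiLp.norm_single]
  obtain ⟨γ, hγ⟩ := hpath _ _ _ (hx d₁ hd₁ hd₁t) _ (hx d₂ hd₂ hd₂t)
  rw [← mul_assoc, mul_div_cancel₀ ε hK.ne'] at hγ
  have hends : x d₁ i₀ = x d₂ i₀ :=
    hcoord_eq _ (isPreconnected_range γ.continuous) hγ _ ⟨0, γ.source⟩ _ ⟨1, γ.target⟩
      (by simp [x, hi.symm, hd₁, hd₂])
  exact hd (by simpa [x, hi.symm] using hends)

end phamBrieskorn

theorem corollary4p3_general {n : ℕ} {a : Fin n → ℂ} {k : Fin n → ℕ} {i₀ : Fin n}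
    (ha₀ : a i₀ ≠ 0) (ha : ∃ i ≠ i₀, a i ≠ 0) (hk₀ : 1 < k i₀)
    (hk : ∀ i ≠ i₀, a i ≠ 0 → k i₀ < k i) :
    ¬ IsNormallyEmbeddedAt (phamBrieskorn a k) 0 := by
  obtain ⟨j, hj₀, hj⟩ := ha
  obtain ⟨i₁, hi₁, hmin⟩ :=
    Finset.exists_min_image {i | i ≠ i₀ ∧ a i ≠ 0} k ⟨j, by simp [hj₀, hj]⟩
  simp only [Finset.mem_filter_univ, and_imp] at hi₁ hmin
  exact not_isNormallyEmbeddedAt_phamBrieskorn ha₀ hi₁.2 hk₀ (hk i₁ hi₁.1 hi₁.2) hmin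

theorem corollary4p3 (n : ℕ) (hn : 2 ≤ n) (a : Fin n → ℂ) (ha : ∀ i, a i ≠ 0)
    (k : Fin n → ℕ)
    (hk₁ : 1 < k ⟨0, by omega⟩)
    (hk₂ : k ⟨0, by omega⟩ < k ⟨1, by omega⟩)
    (hk : ∀ i j : Fin n, 1 ≤ (i : ℕ) → i ≤ j → k i ≤ k j) :
    ¬ IsNormallyEmbeddedAt (phamBrieskorn a k) 0 :=
  corollary4p3_general (ha _) ⟨⟨1, hn⟩, by simp, ha _⟩ hk₁ fun i hi _ =>
    hk₂.trans_le (hk _ i le_rfl (Nat.one_le_iff_ne_zero.mpr fun h => hi (Fin.ext h)))
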